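/- Let $d\ge 2$. For $(\mu,s)\in\mathbb{C}^2$ define $m_0=1,m_1,m_2,\dots$ by $$\sum_{i\ge 0}\frac{m_i}{i!}\,t^i \;=\; \exp(\mu t)\cdot\exp\!\left(\tfrac12 s t^2\right),$$ so that $m_i$ is the $i$-th moment of the Gaussian distribution with mean $\mu$ and variance $s$ when $\mu$ is real and $s \geq 0$. Let $\mathcal{G}_{1,d}\subset\mathbb{P}^d$ (complex projective space) be the Gaussian moment variety of order $d$, that is, the Zariski closure of the set of all points $[m_0:m_1:\cdots:m_d]$ with $(\mu,s)\in\mathbb{C}^2$. Then $\mathcal{G}_{1,d}$ is a surface (it has dimension $2$), and its degree is $\binom{d}{2}$. Here dimension and degree are those given by the Hilbert polynomial $P$ of the homogeneous coordinate ring of $\mathcal{G}_{1,d}$: the dimension is $r=\deg P$, and the degree is $r!$ times the leading coefficient of $P$. -/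

import Mathlib

open scoped LinearAlgebra.Projectivization

noncomputable section

namespace GaussianMoments

/-! ### Projective varieties over the complex numbers, and their degrees -/

/-- Complex projective space `ℙ^d`, with homogeneous coordinates indexed by `0, …, d`. -/
abbrev ProjSpace (d : ℕ) : Type := ℙ ℂ (Fin (d + 1) → ℂ)

/-- The homogeneous vanishing ideal of a subset of `ℙ^d`: all polynomials that vanish at every
vector of homogeneous coordinates of every point of the set. (Since `ℂ` is infinite, this is the
ideal generated by the homogeneous polynomials that vanish on the set.) -/
def vanishingIdeal {d : ℕ} (S : Set (ProjSpace d)) : Ideal (MvPolynomial (Fin (d + 1)) ℂ) where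
  carrier := {f | ∀ (v : Fin (d + 1) → ℂ) (hv : v ≠ 0),
    Projectivization.mk ℂ v hv ∈ S → MvPolynomial.eval v f = 0}
  zero_mem' := fun _ _ _ => map_zero _
  add_mem' := fun hf hg v hv hS => by rw [map_add, hf v hv hS, hg v hv hS, add_zero]
  smul_mem' := fun c f hf v hv hS => by rw [smul_eq_mul, map_mul, hf v hv hS, mul_zero]

/-- The Zariski closure of a subset of `ℙ^d`: the common zeros of all homogeneous polynomials
that vanish on it. -/
def zariskiClosure {d : ℕ} (S : Set (ProjSpace d)) : Set (ProjSpace d) :=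
  {p | ∀ f ∈ vanishingIdeal S, ∀ n : ℕ, f.IsHomogeneous n → MvPolynomial.eval p.rep f = 0}

/-- The Hilbert function of (the homogeneous coordinate ring of) a subset of `ℙ^d`: the dimension
of the space of forms of degree `n` modulo those that vanish on the subset. -/
def hilbertFunction {d : ℕ} (Z : Set (ProjSpace d)) (n : ℕ) : ℕ :=
  Module.finrank ℂ
    (MvPolynomial.homogeneousSubmodule (Fin (d + 1)) ℂ n ⧸
      ((vanishingIdeal Z).restrictScalars ℂ).comap
        (MvPolynomial.homogeneousSubmodule (Fin (d + 1)) ℂ n).subtype)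

/-- `P` is the Hilbert polynomial of `Z`: it agrees with the Hilbert function in all large
degrees. There is at most one such `P`. -/
def IsHilbertPolynomial {d : ℕ} (Z : Set (ProjSpace d)) (P : Polynomial ℚ) : Prop :=
  ∀ᶠ n : ℕ in Filter.atTop, (hilbertFunction Z n : ℚ) = P.eval (n : ℚ)

/-- The closed subset `Z` of `ℙ^d` has dimension `r`: its Hilbert polynomial has degree `r`. -/
def HasDimension {d : ℕ} (Z : Set (ProjSpace d)) (r : ℕ) : Prop :=
  ∃ P : Polynomial ℚ, IsHilbertPolynomial Z P ∧ P.degree = r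

/-- The nonempty closed subset `Z` of `ℙ^d` has degree `e`: if `r` is the degree of its Hilbert
polynomial, then `e` is `r!` times the leading coefficient of that polynomial. -/
def HasDegree {d : ℕ} (Z : Set (ProjSpace d)) (e : ℕ) : Prop :=
  ∃ P : Polynomial ℚ, IsHilbertPolynomial Z P ∧ P ≠ 0 ∧
    (P.natDegree.factorial : ℚ) * P.leadingCoeff = e

/-! ### The Gaussian moment variety for `n = 1` -/

/-- The moment generating function `exp (μ t) * exp (s t² / 2)` of the univariate Gaussian with
mean `μ` and variance `s`, as a formal power series in `t`. -/
def gaussianMGF (μ s : ℂ) : PowerSeries ℂ :=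
  (PowerSeries.exp ℂ).subst (PowerSeries.C μ * PowerSeries.X) *
    (PowerSeries.exp ℂ).subst (PowerSeries.C (s / 2) * PowerSeries.X ^ 2)

/-- The `i`-th moment `m_i`, defined by `∑ i, (m_i / i!) t ^ i = exp (μ t) * exp (s t² / 2)`. -/
def moment (μ s : ℂ) (i : ℕ) : ℂ :=
  (i.factorial : ℂ) * PowerSeries.coeff i (gaussianMGF μ s)

theorem constantCoeff_exp_subst {a : PowerSeries ℂ} (ha : PowerSeries.constantCoeff a = 0) :
    PowerSeries.constantCoeff ((PowerSeries.exp ℂ).subst a) = 1 := by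
  have hs : PowerSeries.HasSubst a := PowerSeries.HasSubst.of_constantCoeff_zero' ha
  have h := PowerSeries.subst_sub hs (PowerSeries.exp ℂ) (PowerSeries.C (1 : ℂ))
  have h0 := PowerSeries.constantCoeff_subst_eq_zero (S := ℂ) ha
    (PowerSeries.exp ℂ - PowerSeries.C (1 : ℂ)) (by simp)
  have hC : PowerSeries.subst a (PowerSeries.C (1 : ℂ)) = (1 : PowerSeries ℂ) := by
    rw [PowerSeries.subst_C]; exact map_one _
  rw [h, hC] at h0
  change PowerSeries.constantCoeff (PowerSeries.subst a (PowerSeries.exp ℂ) - 1) = 0 at h0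
  rw [map_sub, map_one] at h0
  exact sub_eq_zero.mp h0

theorem moment_zero (μ s : ℂ) : moment μ s 0 = 1 := by
  simp [moment, gaussianMGF, constantCoeff_exp_subst]

/-- The vector of moments `(m_0, m_1, …, m_d)`, where `m_0 = 1`. -/
def momentVector (d : ℕ) (μ s : ℂ) : Fin (d + 1) → ℂ := fun i => moment μ s i

theorem momentVector_ne_zero (d : ℕ) (μ s : ℂ) : momentVector d μ s ≠ 0 := fun h =>
  one_ne_zero ((moment_zero μ s).symm.trans (congrFun h 0))

/-- The point `[m_0 : m_1 : ⋯ : m_d]` of `ℙ^d`. -/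
def momentPoint (d : ℕ) (μ s : ℂ) : ProjSpace d :=
  Projectivization.mk ℂ (momentVector d μ s) (momentVector_ne_zero d μ s)

/-- The Gaussian moment variety `𝒢_{1,d}` in `ℙ^d`: the Zariski closure of the image of the
parametrization by moments. -/
def gaussianMomentVariety (d : ℕ) : Set (ProjSpace d) :=
  zariskiClosure (Set.range fun q : ℂ × ℂ => momentPoint d q.1 q.2)

end GaussianMoments

end

namespace GaussianMoments

open MvPolynomial

/-! ### The moments as polynomials in the mean and the variance -/

/-! The moments are polynomials in `μ` and `s`, so the Hilbert function at `n` is the dimension of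
the span of all `n`-fold products of `m_0, …, m_d`, where `m_0 = 1`.

Spanning: the recurrence `m_{i+1} = μ m_i + s (i m_{i-1})` makes the 3-row matrix with columns `(i
m_{i-1}, m_i, m_{i+1})` of rank at most two. Its cubic minors rewrite a product of three moments
with indices in `[1, d-2]` through products of the same degree and total index whose indices are
more spread out. At most two such factors survive, which leaves the standard products `m_{d-1}^a
m_d^b m_i m_j` with `i ≤ j ≤ d-2` (`momentProd_mem_span`).

Independence: no initial ideal is computed. Since `μ = m_1` and `s = m_2 - m_1^2`, the standard
products of weight at most `N` span all monomials of weight at most `N`, where `μ` has weight 1 and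
`s` weight 2. A weight-preserving injection shows that they are no more numerous than these
monomials, hence they are independent (`linearIndepOn_standardProd`).

Counting: each of the `d.choose 2` pairs `(i, j)` contributes a quadratic polynomial in `n` with
leading coefficient `1/2`. -/

/-- The `i`-th Gaussian moment as a polynomial in the mean `X 0` and the variance `X 1`. -/
noncomputable def momentPoly : ℕ → MvPolynomial (Fin 2) ℂ
  | 0 => 1
  | 1 => X 0
  | n + 2 => X 0 * momentPoly (n + 1) + C (n + 1 : ℂ) * X 1 * momentPoly n

/-- At `i = 0` the truncated index `i - 1` is harmless because its coefficient is zero. -/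
theorem momentPoly_succ (i : ℕ) :
    momentPoly (i + 1) = X 0 * momentPoly i + C (i : ℂ) * X 1 * momentPoly (i - 1) := by
  cases i with
  | zero => simp [momentPoly]
  | succ n => simp [momentPoly]

/-- The exponent `μ t + s t² / 2` has derivative `μ + s t`; comparing coefficients in this
differential equation gives the moment recurrence. -/
theorem derivative_gaussianMGF (μ s : ℂ) :
    PowerSeries.derivative ℂ (gaussianMGF μ s) =
      (PowerSeries.C μ + PowerSeries.C s * PowerSeries.X) * gaussianMGF μ s := by
  have h1 : PowerSeries.HasSubst (PowerSeries.C μ * PowerSeries.X : PowerSeries ℂ) :=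
    PowerSeries.HasSubst.of_constantCoeff_zero' (by simp)
  have h2 : PowerSeries.HasSubst (PowerSeries.C (s / 2) * PowerSeries.X ^ 2 : PowerSeries ℂ) :=
    PowerSeries.HasSubst.of_constantCoeff_zero' (by simp)
  have hC : ∀ c : ℂ, PowerSeries.derivative ℂ (PowerSeries.C c) = 0 :=
    fun c => PowerSeries.derivative_C
  have hs : (PowerSeries.C (s / 2) : PowerSeries ℂ) * 2 = PowerSeries.C s := by
    rw [show (2 : PowerSeries ℂ) = PowerSeries.C 2 from (map_ofNat PowerSeries.C 2).symm, ← map_mul]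
    congr 1
    ring
  rw [gaussianMGF, Derivation.leibniz, PowerSeries.derivative_subst h1,
    PowerSeries.derivative_subst h2, PowerSeries.derivative_exp, Derivation.leibniz,
    Derivation.leibniz, hC, hC, Derivation.leibniz_pow, PowerSeries.derivative_X, ← hs]
  simp only [smul_eq_mul, nsmul_eq_mul]
  push_cast
  ring

theorem moment_one (μ s : ℂ) : moment μ s 1 = μ := by
  have h := congrArg (PowerSeries.coeff 0) (derivative_gaussianMGF μ s)
  have h0 := moment_zero μ s
  simp only [moment, Nat.factorial_zero, Nat.cast_one, one_mul] at h0
  rw [PowerSeries.coeff_derivative, add_mul, map_add, mul_assoc, PowerSeries.coeff_C_mul,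
    PowerSeries.coeff_C_mul, PowerSeries.coeff_zero_X_mul, h0] at h
  simpa [moment] using h

theorem moment_succ_succ (μ s : ℂ) (n : ℕ) :
    moment μ s (n + 2) = μ * moment μ s (n + 1) + (n + 1) * s * moment μ s n := by
  have h := congrArg (PowerSeries.coeff (n + 1)) (derivative_gaussianMGF μ s)
  rw [PowerSeries.coeff_derivative, add_mul, map_add, mul_assoc, PowerSeries.coeff_C_mul,
    PowerSeries.coeff_C_mul, PowerSeries.coeff_succ_X_mul] at h
  simp only [moment, Nat.factorial_succ]
  push_cast at h ⊢
  linear_combination ((n : ℂ) + 1) * (n.factorial : ℂ) * h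

theorem moment_eq_eval (μ s : ℂ) (i : ℕ) : moment μ s i = eval ![μ, s] (momentPoly i) := by
  induction i using Nat.twoStepInduction with
  | zero => simp [moment_zero, momentPoly]
  | one => simp [moment_one, momentPoly]
  | more n h1 h2 => simp [moment_succ_succ, momentPoly, h1, h2]

/-! ### The Hilbert function as the dimension of a space of polynomials -/

theorem eval_smul_of_isHomogeneous {σ : Type*} {f : MvPolynomial σ ℂ} {n : ℕ}
    (hf : f.IsHomogeneous n) (c : ℂ) (v : σ → ℂ) : eval (c • v) f = c ^ n * eval v f := by
  rw [eval_eq, eval_eq, Finset.mul_sum]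
  refine Finset.sum_congr rfl fun m hm => ?_
  have hm' : m.degree = n := by
    rw [Finsupp.degree_eq_weight_one]
    exact hf (mem_support_iff.mp hm)
  simp only [Pi.smul_apply, smul_eq_mul, mul_pow, Finset.prod_mul_distrib]
  rw [Finset.prod_pow_eq_pow_sum, ← hm']
  change _ = c ^ (∑ i ∈ m.support, m i) * _
  ring

/-- Homogeneity makes vanishing independent of the representative, which reconciles the single
vector `p.rep` in the closure with the arbitrary vectors in the vanishing ideal. -/
theorem mem_vanishingIdeal_zariskiClosure_iff {d : ℕ} (S : Set (ProjSpace d))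
    {f : MvPolynomial (Fin (d + 1)) ℂ} {n : ℕ} (hf : f.IsHomogeneous n) :
    f ∈ vanishingIdeal (zariskiClosure S) ↔ f ∈ vanishingIdeal S := by
  constructor
  · intro h v hv hS
    refine h v hv fun g hg k _ => hg _ (Projectivization.rep_nonzero _) ?_
    rwa [Projectivization.mk_rep]
  · intro h v hv hS
    have h1 := hS f h n hf
    obtain ⟨a, ha⟩ := Projectivization.exists_smul_eq_mk_rep ℂ v hv
    rw [← ha, Units.smul_def, eval_smul_of_isHomogeneous hf] at h1
    exact (mul_eq_zero.mp h1).resolve_left (pow_ne_zero _ a.ne_zero)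

/-- The substitution of the moment polynomials for the homogeneous coordinates. -/
noncomputable def momentHom (d : ℕ) : MvPolynomial (Fin (d + 1)) ℂ →ₐ[ℂ] MvPolynomial (Fin 2) ℂ :=
  aeval fun i : Fin (d + 1) => momentPoly i

theorem eval_momentHom {d : ℕ} (f : MvPolynomial (Fin (d + 1)) ℂ) (μ s : ℂ) :
    eval ![μ, s] (momentHom d f) = eval (momentVector d μ s) f := by
  have : (eval ![μ, s]).comp (momentHom d : _ →+* MvPolynomial (Fin 2) ℂ) =
      eval (momentVector d μ s) := by
    ext i
    · simp [momentHom]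
    · simp [momentHom, momentVector, moment_eq_eval]
  exact DFunLike.congr_fun this f

theorem mem_vanishingIdeal_gaussianMomentVariety_iff {d n : ℕ}
    {f : MvPolynomial (Fin (d + 1)) ℂ} (hf : f.IsHomogeneous n) :
    f ∈ vanishingIdeal (gaussianMomentVariety d) ↔ momentHom d f = 0 := by
  rw [gaussianMomentVariety, mem_vanishingIdeal_zariskiClosure_iff _ hf]
  constructor
  · intro h
    refine MvPolynomial.funext fun v => ?_
    have hv : v = ![v 0, v 1] := by
      ext i
      fin_cases i <;> rfl
    rw [hv, eval_momentHom, map_zero]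
    exact h _ (momentVector_ne_zero d _ _) ⟨(v 0, v 1), rfl⟩
  · rintro h v hv ⟨⟨μ, s⟩, hq⟩
    obtain ⟨a, ha⟩ := (Projectivization.mk_eq_mk_iff ℂ _ _ (momentVector_ne_zero d μ s) hv).mp hq
    have h1 := eval_momentHom f μ s
    rw [h, map_zero, ← ha, Units.smul_def, eval_smul_of_isHomogeneous hf] at h1
    exact (mul_eq_zero.mp h1.symm).resolve_left (pow_ne_zero _ a.ne_zero)

theorem hilbertFunction_gaussianMomentVariety (d n : ℕ) :
    hilbertFunction (gaussianMomentVariety d) n =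
      Module.finrank ℂ ((homogeneousSubmodule (Fin (d + 1)) ℂ n).map (momentHom d).toLinearMap) := by
  have hker : ((vanishingIdeal (gaussianMomentVariety d)).restrictScalars ℂ).comap
      (homogeneousSubmodule (Fin (d + 1)) ℂ n).subtype =
      LinearMap.ker ((momentHom d).toLinearMap.domRestrict
        (homogeneousSubmodule (Fin (d + 1)) ℂ n)) := by
    ext f
    simpa using mem_vanishingIdeal_gaussianMomentVariety_iff
      ((mem_homogeneousSubmodule n _).mp f.2)
  rw [hilbertFunction, hker, (LinearMap.quotKerEquivRange _).finrank_eq,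
    LinearMap.range_domRestrict]

/-- A product of moment polynomials, indexed by a multiset. -/
noncomputable def momentProd (T : Multiset ℕ) : MvPolynomial (Fin 2) ℂ := (T.map momentPoly).prod

theorem momentProd_cons (i : ℕ) (T : Multiset ℕ) :
    momentProd (i ::ₘ T) = momentPoly i * momentProd T := by
  simp [momentProd]

theorem momentProd_add (S T : Multiset ℕ) :
    momentProd (S + T) = momentProd S * momentProd T := by
  simp [momentProd]

theorem map_homogeneousSubmodule_eq_span (d n : ℕ) :
    (homogeneousSubmodule (Fin (d + 1)) ℂ n).map (momentHom d).toLinearMap =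
      Submodule.span ℂ (momentProd '' {T | (∀ i ∈ T, i ≤ d) ∧ T.card = n}) := by
  rw [homogeneousSubmodule_eq_finsupp_supported, AddMonoidAlgebra.supported_eq_span_single,
    Submodule.map_span, ← Set.image_comp]
  have key : ∀ m : Fin (d + 1) →₀ ℕ, momentHom d (monomial m 1) =
      momentProd (m.toMultiset.map (fun i : Fin (d + 1) => (i : ℕ))) := fun m => by
    rw [momentHom, aeval_monomial, map_one, one_mul, momentProd, Multiset.map_map,
      Finsupp.toMultiset_map, Finsupp.prod_toMultiset, Finsupp.prod_mapDomain_index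
      (fun _ => pow_zero _) (fun _ _ _ => pow_add _ _ _)]
    rfl
  congr 1
  ext p
  constructor
  · rintro ⟨m, hm, rfl⟩
    refine ⟨m.toMultiset.map (fun i : Fin (d + 1) => (i : ℕ)), ⟨?_, ?_⟩, (key m).symm⟩
    · intro i hi
      obtain ⟨j, -, rfl⟩ := Multiset.mem_map.mp hi
      exact Nat.lt_succ_iff.mp j.2
    · rw [Multiset.card_map, Finsupp.card_toMultiset]
      exact hm
  · rintro ⟨T, ⟨hT, hc⟩, rfl⟩
    lift T to Multiset (Fin (d + 1)) using fun i hi => Nat.lt_succ_iff.mpr (hT i hi)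
    refine ⟨Multiset.toFinsupp T, ?_, ?_⟩
    · rw [Multiset.card_map] at hc
      change Finsupp.sum (Multiset.toFinsupp T) (fun _ => id) = n
      rw [← Finsupp.card_toMultiset, Multiset.toFinsupp_toMultiset, hc]
    · refine (key _).trans ?_
      rw [Multiset.toFinsupp_toMultiset]

/-! ### Straightening products of moments -/

/-- The cubic relations among the moments: the `3 × 3` minors of the matrix with rows
`i * m (i - 1)`, `m i`, `m (i + 1)`, solved for their antidiagonal term. -/
theorem momentPoly_minor (i j k : ℕ) :
    C (k : ℂ) * (momentPoly (i + 1) * momentPoly j * momentPoly (k - 1)) =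
      C (i : ℂ) * (momentPoly (i - 1) * momentPoly j * momentPoly (k + 1))
      - C (i : ℂ) * (momentPoly (i - 1) * momentPoly k * momentPoly (j + 1))
      - C (j : ℂ) * (momentPoly i * momentPoly (j - 1) * momentPoly (k + 1))
      + C (k : ℂ) * (momentPoly i * momentPoly (j + 1) * momentPoly (k - 1))
      + C (j : ℂ) * (momentPoly (i + 1) * momentPoly (j - 1) * momentPoly k) := by
  -- The third row is `X 1` times the first plus `X 0` times the second, so the determinant
  -- vanishes.
  rw [momentPoly_succ i, momentPoly_succ j, momentPoly_succ k]
  ring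

/-- The standard products: `((a, b), (i, j))` gives `m_{d-1}^a m_d^b m_i m_j`. -/
noncomputable def standardProd (d : ℕ) (x : (ℕ × ℕ) × (ℕ × ℕ)) : MvPolynomial (Fin 2) ℂ :=
  momentPoly (d - 1) ^ x.1.1 * momentPoly d ^ x.1.2 * (momentPoly x.2.1 * momentPoly x.2.2)

/-- The number of factors `m_i` with `i ≠ 0` among `m_i`, `m_j`. -/
def boxDegree (y : ℕ × ℕ) : ℕ := (if y.1 = 0 then 0 else 1) + (if y.2 = 0 then 0 else 1)

/-- The standard products with a given bound on the degree and on the weight. -/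
def standardSet (d n N : ℕ) : Set ((ℕ × ℕ) × (ℕ × ℕ)) :=
  {x | x.2.1 ≤ x.2.2 ∧ x.2.2 < d - 1 ∧ x.1.1 + x.1.2 + boxDegree x.2 ≤ n ∧
    (d - 1) * x.1.1 + d * x.1.2 + x.2.1 + x.2.2 ≤ N}

theorem exists_momentProd_eq_pow_mul_pow {d : ℕ} (T : Multiset ℕ)
    (hT : ∀ i ∈ T, i = 0 ∨ i = d - 1 ∨ i = d) :
    ∃ a b, momentProd T = momentPoly (d - 1) ^ a * momentPoly d ^ b ∧ a + b ≤ T.card ∧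
      (d - 1) * a + d * b ≤ T.sum := by
  induction T using Multiset.induction_on with
  | empty => exact ⟨0, 0, by simp [momentProd]⟩
  | cons i T ih =>
    obtain ⟨a, b, h, h1, h2⟩ := ih fun j hj => hT j (Multiset.mem_cons_of_mem hj)
    rw [momentProd_cons, h, Multiset.card_cons, Multiset.sum_cons]
    rcases hT i (Multiset.mem_cons_self i T) with rfl | rfl | rfl
    · exact ⟨a, b, by simp [momentPoly], by omega, by omega⟩
    · exact ⟨a + 1, b, by ring, by omega, by rw [mul_add]; omega⟩
    · exact ⟨a, b + 1, by ring, by omega, by rw [mul_add]; omega⟩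

theorem exists_momentProd_eq_box {d : ℕ} (hd : 2 ≤ d) (T : Multiset ℕ)
    (hT : ∀ i ∈ T, 1 ≤ i ∧ i < d - 1) (hc : T.card ≤ 2) :
    ∃ y : ℕ × ℕ, momentProd T = momentPoly y.1 * momentPoly y.2 ∧ y.1 ≤ y.2 ∧ y.2 < d - 1 ∧
      boxDegree y ≤ T.card ∧ y.1 + y.2 = T.sum := by
  interval_cases h : T.card
  · rw [Multiset.card_eq_zero] at h
    subst h
    exact ⟨(0, 0), by simp [momentProd, momentPoly], le_rfl, by simp; omega, by simp [boxDegree],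
      by simp⟩
  · obtain ⟨i, rfl⟩ := Multiset.card_eq_one.mp h
    have := hT i (by simp)
    exact ⟨(0, i), by simp [momentProd, momentPoly], by simp, this.2,
      by simp only [boxDegree]; split_ifs <;> omega, by simp⟩
  · obtain ⟨i, j, rfl⟩ := Multiset.card_eq_two.mp h
    have hi := hT i (by simp)
    have hj := hT j (by simp)
    rcases le_total i j with hij | hij
    · exact ⟨(i, j), by simp [momentProd], hij, hj.2,
        by simp only [boxDegree]; split_ifs <;> omega, by simp⟩
    · exact ⟨(j, i), by simp [momentProd, mul_comm], hij, hi.2,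
        by simp only [boxDegree]; split_ifs <;> omega, by simp [add_comm]⟩

theorem exists_three_sorted {T : Multiset ℕ} (hT : 2 < T.card) :
    ∃ a b c S, a ≤ b ∧ b ≤ c ∧ T = a ::ₘ b ::ₘ c ::ₘ S := by
  obtain ⟨a, b, c, L, h⟩ : ∃ a b c L, T.sort (· ≤ ·) = a :: b :: c :: L := by
    have hl : (T.sort (· ≤ ·)).length = T.card := Multiset.length_sort _
    match hs : T.sort (· ≤ ·) with
    | [] => simp [hs] at hl; omega
    | [a] => simp [hs] at hl; omega
    | [a, b] => simp [hs] at hl; omega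
    | a :: b :: c :: L => exact ⟨a, b, c, L, rfl⟩
  have hp := Multiset.pairwise_sort T (· ≤ ·)
  rw [h] at hp
  simp only [List.pairwise_cons, List.mem_cons] at hp
  refine ⟨a, b, c, L, hp.1 b (by simp), hp.2.1 c (by simp), ?_⟩
  rw [← Multiset.sort_eq T (· ≤ ·), h]
  rfl

theorem sum_map_sq_le {d : ℕ} (T : Multiset ℕ) (hT : ∀ i ∈ T, i ≤ d) :
    (T.map (· ^ 2)).sum ≤ T.card * d ^ 2 := by
  have := Multiset.sum_le_card_nsmul (T.map (· ^ 2)) (d ^ 2) (by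
    intro x hx
    obtain ⟨i, hi, rfl⟩ := Multiset.mem_map.mp hx
    exact Nat.pow_le_pow_left (hT i hi) 2)
  simpa using this

theorem momentProd_mem_span {d : ℕ} (hd : 2 ≤ d) (T : Multiset ℕ) (hT : ∀ i ∈ T, i ≤ d) :
    momentProd T ∈ Submodule.span ℂ (standardProd d '' standardSet d T.card T.sum) := by
  -- Straightening fixes the cardinality and the sum but increases the sum of squares, which is
  -- bounded by `T.card * d ^ 2`; the gap is the induction measure.
  induction hk : T.card * d ^ 2 - (T.map (· ^ 2)).sum using Nat.strong_induction_on
    generalizing T with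
  | _ k ih =>
  have hsplit := Multiset.filter_add_not (fun i => 1 ≤ i ∧ i < d - 1) T
  have hmid : ∀ i ∈ T.filter (fun i => 1 ≤ i ∧ i < d - 1), 1 ≤ i ∧ i < d - 1 :=
    fun i hi => (Multiset.mem_filter.mp hi).2
  rcases le_or_gt (T.filter (fun i => 1 ≤ i ∧ i < d - 1)).card 2 with hc | hc
  · obtain ⟨y, hy, hy1, hy2, hy3, hy4⟩ := exists_momentProd_eq_box hd _ hmid hc
    obtain ⟨a, b, hab, hab1, hab2⟩ := exists_momentProd_eq_pow_mul_pow (d := d)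
      (T.filter (fun i => ¬(1 ≤ i ∧ i < d - 1))) (by
        intro i hi
        obtain ⟨h1, h2⟩ := Multiset.mem_filter.mp hi
        have := hT i h1
        omega)
    have hcard := congrArg Multiset.card hsplit
    have hsum := congrArg Multiset.sum hsplit
    rw [Multiset.card_add] at hcard
    rw [Multiset.sum_add] at hsum
    refine Submodule.subset_span ⟨((a, b), y), ⟨hy1, hy2, ?_, ?_⟩, ?_⟩
    · dsimp only; omega
    · dsimp only; omega
    · rw [← hsplit, momentProd_add, hy, hab, standardProd, mul_comm]
  · obtain ⟨a, b, c, S, hle, hle', hS⟩ := exists_three_sorted hc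
    rw [hS] at hsplit hmid
    have ha := hmid a (by simp)
    have hb := hmid b (by simp)
    have hcc := hmid c (by simp)
    obtain ⟨U, hU⟩ : ∃ U, T = a ::ₘ b ::ₘ c ::ₘ U :=
      ⟨_, by rw [← hsplit]; simp only [Multiset.cons_add]; rfl⟩
    clear hsplit hS hc hmid
    subst hU
    have hUd : ∀ i ∈ U, i ≤ d := fun i hi => hT i (by simp [hi])
    have step : ∀ x y z : ℕ, x ≤ d → y ≤ d → z ≤ d → x + y + z = a + b + c →
        a ^ 2 + b ^ 2 + c ^ 2 < x ^ 2 + y ^ 2 + z ^ 2 →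
        momentPoly x * momentPoly y * momentPoly z * momentProd U ∈ Submodule.span ℂ
          (standardProd d '' standardSet d (a ::ₘ b ::ₘ c ::ₘ U).card
            (a ::ₘ b ::ₘ c ::ₘ U).sum) := by
      intro x y z hx hy hz hsum hsq
      have hT' : ∀ i ∈ x ::ₘ y ::ₘ z ::ₘ U, i ≤ d := by
        simp only [Multiset.mem_cons]
        rintro i (rfl | rfl | rfl | hi)
        exacts [hx, hy, hz, hUd i hi]
      have hbd := sum_map_sq_le _ hT'
      have := ih _ ?_ (x ::ₘ y ::ₘ z ::ₘ U) hT' rfl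
      · simp only [momentProd_cons, Multiset.card_cons, Multiset.sum_cons, ← mul_assoc,
          ← add_assoc] at this ⊢
        rwa [hsum] at this
      · simp only [Multiset.card_cons, Multiset.sum_cons, Multiset.map_cons] at hbd hk ⊢
        omega
    have hCm : ∀ (r : ℂ) (p : MvPolynomial (Fin 2) ℂ), C r * p = r • p := fun r p =>
      (smul_eq_C_mul p r).symm
    obtain ⟨i, rfl⟩ : ∃ i, a = i + 1 := ⟨a - 1, by omega⟩
    obtain ⟨j, rfl⟩ : ∃ j, b = j + 1 := ⟨b - 1, by omega⟩
    -- The indices are shifted so that the antidiagonal term is the given triple `(i + 1, j + 1,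
    -- c)`. The largest new index is `c + 2 ≤ d`, because `c < d - 1`.
    have hid := momentPoly_minor i (j + 1) (c + 1)
    simp only [hCm, Nat.add_sub_cancel] at hid
    have hne : ((c + 1 : ℕ) : ℂ) ≠ 0 := Nat.cast_ne_zero.mpr (by omega)
    rw [momentProd_cons, momentProd_cons, momentProd_cons, ← mul_assoc, ← mul_assoc,
      ← Submodule.smul_mem_iff _ hne, ← smul_mul_assoc, hid]
    simp only [add_mul, sub_mul, smul_mul_assoc]
    -- The two terms containing `m_{i-1}` carry the coefficient `i`, so they matter only for `i ≥
    -- 1`, when the subtraction does not truncate.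
    have hi0 : ∀ w, (1 ≤ i → w ∈ Submodule.span ℂ (standardProd d ''
        standardSet d ((i + 1) ::ₘ (j + 1) ::ₘ c ::ₘ U).card
          ((i + 1) ::ₘ (j + 1) ::ₘ c ::ₘ U).sum)) → (i : ℂ) • w ∈ Submodule.span ℂ
        (standardProd d '' standardSet d ((i + 1) ::ₘ (j + 1) ::ₘ c ::ₘ U).card
          ((i + 1) ::ₘ (j + 1) ::ₘ c ::ₘ U).sum) := by
      intro w hw
      rcases Nat.eq_zero_or_pos i with rfl | h
      · simp
      · exact Submodule.smul_mem _ _ (hw h)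
    refine add_mem (add_mem (sub_mem (sub_mem (hi0 _ fun h1 => ?_) (hi0 _ fun h1 => ?_))
      (Submodule.smul_mem _ _ ?_)) (Submodule.smul_mem _ _ ?_)) (Submodule.smul_mem _ _ ?_)
    · obtain ⟨i, rfl⟩ : ∃ l, i = l + 1 := ⟨i - 1, by omega⟩
      exact step _ _ _ (by omega) (by omega) (by omega) (by omega)
        (by simp only [Nat.add_sub_cancel]; nlinarith)
    · obtain ⟨i, rfl⟩ : ∃ l, i = l + 1 := ⟨i - 1, by omega⟩
      exact step _ _ _ (by omega) (by omega) (by omega) (by omega)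
        (by simp only [Nat.add_sub_cancel]; nlinarith)
    · exact step _ _ _ (by omega) (by omega) (by omega) (by omega) (by nlinarith)
    · exact step _ _ _ (by omega) (by omega) (by omega) (by omega) (by nlinarith)
    · exact step _ _ _ (by omega) (by omega) (by omega) (by omega) (by nlinarith)

/-! ### Linear independence of the standard products -/

/-- The index set of the standard products of weight at most `N`. -/
def standardWeightSet (d N : ℕ) : Set ((ℕ × ℕ) × (ℕ × ℕ)) :=
  {x | x.2.1 ≤ x.2.2 ∧ x.2.2 < d - 1 ∧ (d - 1) * x.1.1 + d * x.1.2 + x.2.1 + x.2.2 ≤ N}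

theorem standardSet_subset (d n N : ℕ) : standardSet d n N ⊆ standardWeightSet d N :=
  fun _ hx => ⟨hx.1, hx.2.1, hx.2.2.2⟩

/-- Factors `X 1 = m_2 - m_1^2` and `X 0 = m_1` are absorbed into `T` one at a time without changing
the total weight; straightening finishes once the monomial is used up. -/
theorem momentProd_mul_monomial_mem_span {d : ℕ} (hd : 2 ≤ d) (p q : ℕ) (T : Multiset ℕ)
    (hT : ∀ i ∈ T, i ≤ d) :
    momentProd T * (X 0 ^ p * X 1 ^ q) ∈
      Submodule.span ℂ (standardProd d '' standardWeightSet d (T.sum + (p + 2 * q))) := by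
  induction q generalizing T with
  | succ q ih =>
    have h1 := ih (2 ::ₘ T) (by simpa [hd] using hT)
    have h2 := ih (1 ::ₘ 1 ::ₘ T) (by simpa [show 1 ≤ d by omega] using hT)
    simp only [Multiset.sum_cons] at h1 h2
    rw [show 2 + T.sum + (p + 2 * q) = T.sum + (p + 2 * (q + 1)) by ring] at h1
    rw [show 1 + (1 + T.sum) + (p + 2 * q) = T.sum + (p + 2 * (q + 1)) by ring] at h2
    convert sub_mem h1 h2 using 1
    simp only [momentProd_cons, momentPoly]
    simp
    ring
  | zero =>
    induction p generalizing T with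
    | zero =>
      have := momentProd_mem_span hd T hT
      simp only [pow_zero, mul_one, mul_zero, add_zero]
      exact Submodule.span_mono (Set.image_mono (standardSet_subset _ _ _)) this
    | succ p ih =>
      have h1 := ih (1 ::ₘ T) (by simpa [show 1 ≤ d by omega] using hT)
      simp only [Multiset.sum_cons] at h1
      rw [show 1 + T.sum + (p + 2 * 0) = T.sum + (p + 1 + 2 * 0) by ring] at h1
      convert h1 using 1
      simp only [momentProd_cons, momentPoly]
      ring

/-! ### Weight-preserving comparison with monomials -/

/-- The exponents of the monomials of weight at most `N`, where `X 0` has weight `1` and `X 1` has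
weight `2`. -/
def monomialWeightSet (N : ℕ) : Set (ℕ × ℕ) := {y | y.1 + 2 * y.2 ≤ N}

theorem finite_monomialWeightSet (N : ℕ) : (monomialWeightSet N).Finite :=
  ((Set.finite_Iic N).prod (Set.finite_Iic N)).subset fun y (hy : y.1 + 2 * y.2 ≤ N) =>
    ⟨show y.1 ≤ N by omega, show y.2 ≤ N by omega⟩

/-- A weight-preserving injection from the pairs `i ≤ j < d - 1`, with weight `i + j`, to a box of
pairs `(α, β)`, with weight `2 α + β`. -/
def boxMap (d : ℕ) (y : ℕ × ℕ) : ℕ × ℕ :=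
  if y.1 < d / 2 then (y.1, y.2 - y.1)
  else (y.2 + d / 2 - (d - 1), (if Even d then d - 1 else d) - 1 - (y.2 - y.1))

theorem boxMap_spec {d : ℕ} {y : ℕ × ℕ} (h1 : y.1 ≤ y.2) (h2 : y.2 < d - 1) :
    (boxMap d y).1 < d / 2 ∧ (boxMap d y).2 < (if Even d then d - 1 else d) ∧
      (boxMap d y).2 + 2 * (boxMap d y).1 = y.1 + y.2 := by
  simp only [boxMap, Nat.even_iff]
  split_ifs <;> dsimp only <;> omega

/-- Each branch is injective, and the images are disjoint: `α + β = j < d - 1` in the first branch,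
while `α + β ≥ d - 1` in the second. -/
theorem boxMap_injOn (d : ℕ) : Set.InjOn (boxMap d) {y | y.1 ≤ y.2 ∧ y.2 < d - 1} := by
  rintro ⟨i, j⟩ ⟨h1, h2⟩ ⟨k, l⟩ ⟨h3, h4⟩ h
  simp only [boxMap, Nat.even_iff] at h h1 h2 h3 h4 ⊢
  split_ifs at h <;> simp only [Prod.mk.injEq] at h ⊢ <;> omega

/-- A weight-preserving injection from the standard products to the monomials in the mean and the
variance. -/
def exponentMap (d : ℕ) (x : (ℕ × ℕ) × (ℕ × ℕ)) : ℕ × ℕ :=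
  if Even d then ((boxMap d x.2).2 + (d - 1) * x.1.1, (boxMap d x.2).1 + d / 2 * x.1.2)
  else ((boxMap d x.2).2 + d * x.1.2, (boxMap d x.2).1 + d / 2 * x.1.1)

theorem eq_and_eq_of_add_mul_eq {m r r' q q' : ℕ} (hr : r < m) (hr' : r' < m)
    (h : r + m * q = r' + m * q') : r = r' ∧ q = q' := by
  have h1 := congrArg (· % m) h
  simp only [Nat.add_mul_mod_self_left, Nat.mod_eq_of_lt hr, Nat.mod_eq_of_lt hr'] at h1
  subst h1
  exact ⟨rfl, Nat.eq_of_mul_eq_mul_left (by omega) (Nat.add_left_cancel h)⟩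

/-- Uniqueness of division with remainder: of `d - 1` and `d`, the odd one is the modulus for the
exponent of `μ`, and half the even one is the modulus for the exponent of `s`. The `boxMap` image
supplies the remainders, `a` and `b` the quotients. -/
theorem exponentMap_injOn (d N : ℕ) : Set.InjOn (exponentMap d) (standardWeightSet d N) := by
  rintro ⟨⟨a, b⟩, y⟩ ⟨h1, h2, -⟩ ⟨⟨a', b'⟩, y'⟩ ⟨h1', h2', -⟩ h
  obtain ⟨s1, s2, -⟩ := boxMap_spec h1 h2
  obtain ⟨t1, t2, -⟩ := boxMap_spec h1' h2'
  have hab : a = a' ∧ b = b' ∧ boxMap d y = boxMap d y' := by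
    simp only [exponentMap] at h s1 s2 t1 t2
    split_ifs at h s2 t2 <;> rw [Prod.mk.injEq] at h
    · have u := eq_and_eq_of_add_mul_eq s2 t2 h.1
      have v := eq_and_eq_of_add_mul_eq s1 t1 h.2
      exact ⟨u.2, v.2, Prod.ext v.1 u.1⟩
    · have u := eq_and_eq_of_add_mul_eq s2 t2 h.1
      have v := eq_and_eq_of_add_mul_eq s1 t1 h.2
      exact ⟨v.2, u.2, Prod.ext v.1 u.1⟩
  obtain ⟨rfl, rfl, hy⟩ := hab
  exact congrArg (Prod.mk (a, b)) (boxMap_injOn d ⟨h1, h2⟩ ⟨h1', h2'⟩ hy)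

theorem exponentMap_mapsTo (d N : ℕ) :
    Set.MapsTo (exponentMap d) (standardWeightSet d N) (monomialWeightSet N) := by
  rintro ⟨⟨a, b⟩, y⟩ ⟨h1, h2, h3⟩
  obtain ⟨-, -, s⟩ := boxMap_spec h1 h2
  simp only [exponentMap, monomialWeightSet] at h3 s ⊢
  split_ifs with hd
  · have h : 2 * (d / 2 * b) = d * b := by rw [← mul_assoc, Nat.two_mul_div_two_of_even hd]
    change _ + 2 * _ ≤ N
    dsimp only
    omega
  · have h : 2 * (d / 2 * a) = (d - 1) * a := by
      rw [← mul_assoc]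
      congr 1
      rw [Nat.even_iff] at hd
      omega
    change _ + 2 * _ ≤ N
    dsimp only
    omega

theorem finite_standardWeightSet (d N : ℕ) : (standardWeightSet d N).Finite :=
  Set.Finite.of_injOn (exponentMap_mapsTo d N) (exponentMap_injOn d N) (finite_monomialWeightSet N)

theorem linearIndependent_monomials :
    LinearIndependent ℂ fun y : ℕ × ℕ => (X 0 ^ y.1 * X 1 ^ y.2 : MvPolynomial (Fin 2) ℂ) := by
  have hinj : Function.Injective fun y : ℕ × ℕ =>
      (Finsupp.single 0 y.1 + Finsupp.single 1 y.2 : Fin 2 →₀ ℕ) := by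
    intro y z h
    have h0 := DFunLike.congr_fun h 0
    have h1 := DFunLike.congr_fun h 1
    simp at h0 h1
    exact Prod.ext h0 h1
  have h := (basisMonomials (Fin 2) ℂ).linearIndependent.comp _ hinj
  have hfun : (fun y : ℕ × ℕ => (X 0 ^ y.1 * X 1 ^ y.2 : MvPolynomial (Fin 2) ℂ)) =
      (basisMonomials (Fin 2) ℂ) ∘ fun y : ℕ × ℕ =>
        (Finsupp.single 0 y.1 + Finsupp.single 1 y.2 : Fin 2 →₀ ℕ) := by
    funext y
    simp [X_pow_eq_monomial, monomial_mul]
  rw [hfun]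
  exact h

/-- A finite family is independent once its span has dimension at least its cardinality. Here the
span contains all monomials of weight at most `N`, and these are at least as numerous as the family.
-/
theorem linearIndepOn_standardProd {d : ℕ} (hd : 2 ≤ d) (N : ℕ) :
    LinearIndepOn ℂ (standardProd d) (standardWeightSet d N) := by
  have : Fintype (standardWeightSet d N) := (finite_standardWeightSet d N).fintype
  have : Fintype (monomialWeightSet N) := (finite_monomialWeightSet N).fintype
  have hfin : FiniteDimensional ℂ
      (Submodule.span ℂ (standardProd d '' standardWeightSet d N)) :=
    FiniteDimensional.span_of_finite ℂ ((finite_standardWeightSet d N).image _)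
  refine linearIndependent_iff_card_le_finrank_span.mpr ?_
  have hcard : Fintype.card (standardWeightSet d N) ≤ Fintype.card (monomialWeightSet N) :=
    Fintype.card_le_of_injective _
      ((exponentMap_mapsTo d N).restrict_inj.mpr (exponentMap_injOn d N))
  have hmono := finrank_span_eq_card (linearIndependent_monomials.comp
    (Subtype.val : monomialWeightSet N → ℕ × ℕ) Subtype.val_injective)
  rw [Set.finrank, ← Set.image_eq_range]
  refine hcard.trans (hmono.symm.le.trans (Submodule.finrank_mono (Submodule.span_le.mpr ?_)))
  rintro _ ⟨⟨y, hy⟩, rfl⟩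
  have h := momentProd_mul_monomial_mem_span hd y.1 y.2 0 (by simp)
  rw [Multiset.sum_zero, zero_add] at h
  have hsub : standardWeightSet d (y.1 + 2 * y.2) ⊆ standardWeightSet d N :=
    fun x hx => ⟨hx.1, hx.2.1, hx.2.2.trans hy⟩
  simpa [momentProd] using Submodule.span_mono (Set.image_mono hsub) h

/-! ### The Hilbert function -/

/-- Since `m_0 = 1`, a product of degree at most `n` can be padded with zero indices to exactly `n`
factors. -/
theorem exists_momentProd_eq_standardProd {d n : ℕ} {x : (ℕ × ℕ) × (ℕ × ℕ)}
    (hx : x.2.1 ≤ x.2.2 ∧ x.2.2 < d - 1 ∧ x.1.1 + x.1.2 + boxDegree x.2 ≤ n) :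
    ∃ T : Multiset ℕ, (∀ i ∈ T, i ≤ d) ∧ T.card = n ∧ momentProd T = standardProd d x := by
  obtain ⟨⟨a, b⟩, i, j⟩ := x
  obtain ⟨hij, hj, hn⟩ := hx
  have single : ∀ i ≤ d, ∃ T : Multiset ℕ, (∀ l ∈ T, l ≤ d) ∧
      T.card = (if i = 0 then 0 else 1) ∧ momentProd T = momentPoly i := by
    intro i hi
    by_cases h : i = 0
    · exact ⟨0, by simp, by simp [h], by simp [h, momentProd, momentPoly]⟩
    · exact ⟨{i}, by simpa using hi, by simp [h], by simp [momentProd]⟩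
  dsimp only at hij hj hn
  obtain ⟨S, hS, hSc, hSp⟩ := single i (by omega)
  obtain ⟨T, hT, hTc, hTp⟩ := single j (by omega)
  refine ⟨Multiset.replicate a (d - 1) + Multiset.replicate b d + (S + T) +
    Multiset.replicate (n - (a + b + boxDegree (i, j))) 0, ?_, ?_, ?_⟩
  · simp only [Multiset.mem_add, Multiset.mem_replicate]
    rintro l (((h | h) | h | h) | h)
    exacts [by omega, by omega, hS l h, hT l h, by omega]
  · simp only [Multiset.card_add, Multiset.card_replicate, hSc, hTc]
    simp only [boxDegree] at hn ⊢
    omega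
  · simp only [momentProd_add, hSp, hTp, standardProd]
    simp [momentProd, momentPoly]

/-- Every index is at most `d`, so the weight bound `n * d` follows from the degree bound and drops
out of the count. -/
theorem weight_le_of_degree_le {d n : ℕ} {x : (ℕ × ℕ) × (ℕ × ℕ)}
    (hij : x.2.1 ≤ x.2.2) (hj : x.2.2 < d - 1) (hn : x.1.1 + x.1.2 + boxDegree x.2 ≤ n) :
    (d - 1) * x.1.1 + d * x.1.2 + x.2.1 + x.2.2 ≤ n * d := by
  have hbox : x.2.1 + x.2.2 ≤ boxDegree x.2 * d := by
    rw [boxDegree, add_mul]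
    split_ifs <;> omega
  have h1 : (d - 1) * x.1.1 ≤ d * x.1.1 := Nat.mul_le_mul_right _ (Nat.sub_le d 1)
  have h2 := Nat.mul_le_mul_right d hn
  linarith [add_mul (x.1.1 + x.1.2) (boxDegree x.2) d, add_mul x.1.1 x.1.2 d, mul_comm d x.1.1,
    mul_comm d x.1.2]

theorem map_homogeneousSubmodule_eq_span_standardProd {d : ℕ} (hd : 2 ≤ d) (n : ℕ) :
    (homogeneousSubmodule (Fin (d + 1)) ℂ n).map (momentHom d).toLinearMap =
      Submodule.span ℂ (standardProd d '' standardSet d n (n * d)) := by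
  rw [map_homogeneousSubmodule_eq_span]
  apply le_antisymm <;> refine Submodule.span_le.mpr ?_
  · rintro _ ⟨T, ⟨hT, rfl⟩, rfl⟩
    have hs : T.sum ≤ T.card * d := by simpa using Multiset.sum_le_card_nsmul T d hT
    have hsub : standardSet d T.card T.sum ⊆ standardSet d T.card (T.card * d) :=
      fun x hx => ⟨hx.1, hx.2.1, hx.2.2.1, hx.2.2.2.trans hs⟩
    exact Submodule.span_mono (Set.image_mono hsub) (momentProd_mem_span hd T hT)
  · rintro _ ⟨x, hx, rfl⟩
    obtain ⟨T, hT, hc, hp⟩ := exists_momentProd_eq_standardProd ⟨hx.1, hx.2.1, hx.2.2.1⟩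
    exact Submodule.subset_span ⟨T, ⟨hT, hc⟩, hp⟩

/-! ### Counting the standard products -/

/-- The pairs `i ≤ j < d - 1`. -/
def box (d : ℕ) : Finset (ℕ × ℕ) :=
  {y ∈ Finset.range (d - 1) ×ˢ Finset.range (d - 1) | y.1 ≤ y.2}

theorem card_box {d : ℕ} (hd : 2 ≤ d) : (box d).card = d.choose 2 := by
  have h : ∀ j ∈ Finset.range (d - 1),
      (∑ i ∈ Finset.range (d - 1), if i ≤ j then 1 else 0) = j + 1 := by
    intro j hj
    rw [← Finset.card_filter, ← Finset.card_range (j + 1)]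
    congr 1
    ext i
    simp only [Finset.mem_filter, Finset.mem_range] at hj ⊢
    omega
  rw [box, Finset.card_filter, Finset.sum_product_right, Finset.sum_congr rfl h,
    Nat.choose_two_right, ← Finset.sum_range_id]
  obtain ⟨e, rfl⟩ : ∃ e, d = e + 1 := ⟨d - 1, by omega⟩
  rw [Finset.sum_range_succ' (fun i => i) e]
  simp

/-- The fibre over `z.1 + z.2 = k` is a full antidiagonal with `k + 1` elements; `m ≤ n` ensures
that the ambient square does not cut it off. -/
theorem card_pairs_add_le {m n : ℕ} (h : m ≤ n) :
    ((Finset.range (n + 1) ×ˢ Finset.range (n + 1)).filter fun z => z.1 + z.2 ≤ m).card * 2 =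
      (m + 1) * (m + 2) := by
  rw [Finset.card_eq_sum_card_fiberwise (f := fun z : ℕ × ℕ => z.1 + z.2)
    (t := Finset.range (m + 1))
    (fun z hz => by
      have := (Finset.mem_filter.mp hz).2
      simpa [Nat.lt_succ_iff] using this)]
  have hfib : ∀ k ∈ Finset.range (m + 1),
      (((Finset.range (n + 1) ×ˢ Finset.range (n + 1)).filter fun z => z.1 + z.2 ≤ m).filter
        fun z => z.1 + z.2 = k).card = k + 1 := by
    intro k hk
    refine Eq.trans (congrArg Finset.card ?_) (Finset.Nat.card_antidiagonal k)
    ext z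
    rw [Finset.HasAntidiagonal.mem_antidiagonal]
    simp only [Finset.mem_filter, Finset.mem_product, Finset.mem_range] at hk ⊢
    omega
  rw [Finset.sum_congr rfl hfib]
  have := Finset.sum_range_id_mul_two (m + 2)
  rw [Finset.sum_range_succ'] at this
  rw [← add_zero (∑ k ∈ Finset.range (m + 1), (k + 1)), this]
  simp [mul_comm]

theorem boxDegree_le_two (y : ℕ × ℕ) : boxDegree y ≤ 2 := by
  rw [boxDegree]
  split_ifs <;> omega

theorem ncard_standardSet (d : ℕ) {n : ℕ} (hn : 2 ≤ n) :
    ((standardSet d n (n * d)).ncard : ℚ) =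
      ∑ y ∈ box d, 1 / 2 * ((n : ℚ) + (1 - boxDegree y)) * (n + (2 - boxDegree y)) := by
  have hset : standardSet d n (n * d) =
      (((Finset.range (n + 1) ×ˢ Finset.range (n + 1)) ×ˢ box d).filter
        fun x => x.1.1 + x.1.2 ≤ n - boxDegree x.2 : Finset ((ℕ × ℕ) × (ℕ × ℕ))) := by
    ext x
    have hdeg := boxDegree_le_two x.2
    simp only [Finset.coe_filter, Finset.mem_product, Finset.mem_range, box, Finset.mem_filter]
    constructor
    · rintro ⟨h1, h2, h3, -⟩
      refine ⟨⟨⟨?_, ?_⟩, ⟨?_, ?_⟩, h1⟩, ?_⟩ <;> omega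
    · rintro ⟨⟨-, ⟨-, h2⟩, h1⟩, h3⟩
      have h3' : x.1.1 + x.1.2 + boxDegree x.2 ≤ n := by omega
      exact ⟨h1, h2, h3', weight_le_of_degree_le h1 h2 h3'⟩
  rw [hset, Set.ncard_coe_finset, Finset.card_filter, Finset.sum_product_right, Nat.cast_sum]
  refine Finset.sum_congr rfl fun y _ => ?_
  rw [← Finset.card_filter]
  have hdeg := boxDegree_le_two y
  have h := congrArg (Nat.cast : ℕ → ℚ) (card_pairs_add_le (Nat.sub_le n (boxDegree y)))
  -- The subtraction `n - boxDegree y` is exact because `boxDegree y ≤ 2 ≤ n`.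
  push_cast [Nat.cast_sub (hdeg.trans hn)] at h
  push_cast
  linear_combination (1 / 2 : ℚ) * h

/-- The Hilbert polynomial of the Gaussian moment variety. -/
noncomputable def gaussianHilbertPoly (d : ℕ) : Polynomial ℚ :=
  ∑ y ∈ box d, Polynomial.C (1 / 2) * (Polynomial.X + Polynomial.C (1 - (boxDegree y : ℚ))) *
    (Polynomial.X + Polynomial.C (2 - (boxDegree y : ℚ)))

theorem isHilbertPolynomial_gaussianHilbertPoly {d : ℕ} (hd : 2 ≤ d) :
    IsHilbertPolynomial (gaussianMomentVariety d) (gaussianHilbertPoly d) := by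
  filter_upwards [Filter.eventually_ge_atTop 2] with n hn
  have hsub := standardSet_subset d n (n * d)
  have : Fintype (standardSet d n (n * d)) :=
    ((finite_standardWeightSet d (n * d)).subset hsub).fintype
  have hli := (linearIndepOn_standardProd hd (n * d)).mono hsub
  rw [hilbertFunction_gaussianMomentVariety, map_homogeneousSubmodule_eq_span_standardProd hd,
    Set.image_eq_range, finrank_span_eq_card hli, ← Nat.card_eq_fintype_card]
  refine (ncard_standardSet d hn).trans ?_
  simp [gaussianHilbertPoly, Polynomial.eval_finsetSum]

theorem natDegree_gaussianHilbertPoly_le (d : ℕ) : (gaussianHilbertPoly d).natDegree ≤ 2 := by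
  refine Polynomial.natDegree_sum_le_of_forall_le _ _ fun y _ => ?_
  compute_degree

theorem coeff_two_gaussianHilbertPoly {d : ℕ} (hd : 2 ≤ d) :
    (gaussianHilbertPoly d).coeff 2 = d.choose 2 / 2 := by
  have h : ∀ a b : ℚ, (Polynomial.C (1 / 2) * (Polynomial.X + Polynomial.C a) *
      (Polynomial.X + Polynomial.C b)).coeff 2 = 1 / 2 := by
    intro a b
    rw [mul_assoc, Polynomial.coeff_C_mul, Polynomial.coeff_mul]
    simp [Finset.Nat.antidiagonal_succ, Polynomial.coeff_X, Polynomial.coeff_C]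
  simp only [gaussianHilbertPoly, Polynomial.finsetSum_coeff, h, Finset.sum_const, card_box hd,
    nsmul_eq_mul]
  ring

theorem natDegree_gaussianHilbertPoly {d : ℕ} (hd : 2 ≤ d) :
    (gaussianHilbertPoly d).natDegree = 2 := by
  refine Polynomial.natDegree_eq_of_le_of_coeff_ne_zero (natDegree_gaussianHilbertPoly_le d) ?_
  rw [coeff_two_gaussianHilbertPoly hd]
  have := Nat.choose_pos hd
  positivity

end GaussianMoments

theorem mainTheorem6 (d : ℕ) (hd : 2 ≤ d) :
    GaussianMoments.HasDimension (GaussianMoments.gaussianMomentVariety d) 2 ∧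
      GaussianMoments.HasDegree (GaussianMoments.gaussianMomentVariety d) (d.choose 2) := by
  have hP := GaussianMoments.isHilbertPolynomial_gaussianHilbertPoly hd
  have hdeg := GaussianMoments.natDegree_gaussianHilbertPoly hd
  have h0 : GaussianMoments.gaussianHilbertPoly d ≠ 0 := by
    intro h
    simp [h] at hdeg
  refine ⟨⟨_, hP, ?_⟩, ⟨_, hP, h0, ?_⟩⟩
  · rw [Polynomial.degree_eq_natDegree h0, hdeg]
  · rw [Polynomial.leadingCoeff, hdeg, GaussianMoments.coeff_two_gaussianHilbertPoly hd]
    norm_num [Nat.factorial]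
    ring
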